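/- Let $\Omega\subset\mathbb R^n$ be open and connected with $C^1$ boundary and $\Omega+\mathbb Z^n=\Omega$; for $\varepsilon>0$ put $\Omega_\varepsilon=\varepsilon\Omega$. Assume: - $(\mathcal A_1)$ $H\in C(\mathbb R^n\times\mathbb R^n)$, and $y\mapsto H(y,p)$ is $\mathbb Z^n$-periodic for each $p$; - $(\mathcal A_2)$ $\lim_{|p|\to\infty}\inf_{y}H(y,p)=+\infty$; - $(\mathcal A_3)$ $p\mapsto H(y,p)$ is convex for each $y$; - $(\mathcal A_4)$ $b\in \mathrm{BUC}(\mathbb R^n\times\partial\Omega)$, and $y\mapsto b(x,y)$ is $\mathbb Z^n$-periodic on $\partial\Omega$ for each $x$; - $(\mathcal A_5)$ $g\in\mathrm{BUC}(\mathbb R^n)\cap\mathrm{Lip}(\mathbb R^n)$, and $g(x)\le\min_{z\in\partial\Omega}b(x,z)$ for all $x\in\mathbb R^n$. Let $L(y,v)=\sup_{p\in\mathbb R^n}(p\cdot v-H(y,p))\in(-\infty,+\infty]$ and $\partial Q_t=(\partial\Omega\times(0,t))\cup(\overline\Omega\times\{0\})$; let $f_\varepsilon(x,0)=g(x)$ for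 $x\in\overline\Omega_\varepsilon$ and $f_\varepsilon(x,s)=b(x,x/\varepsilon)$ for $x\in\partial\Omega_\varepsilon$, $s>0$. For $\varepsilon,t>0$ and $x\in\overline\Omega_\varepsilon$ let $u^\varepsilon(x,t)$ be given by the optimal control formula $$u^\varepsilon(x,t)=\inf\Big\{\varepsilon\int_{\tau/\varepsilon}^{t/\varepsilon}L(\gamma,\dot\gamma)\,ds+f_\varepsilon\big(\varepsilon\gamma(\tfrac\tau\varepsilon),\tau\big)\Big\},$$ where the infimum is over all $\tau\in[0,t)$ and all absolutely continuous $\gamma:[0,t/\varepsilon]\to\overline\Omega$ with $\gamma(t/\varepsilon)=x/\varepsilon$ and $(\gamma(\tau/\varepsilon),\tau)\in\partial Q_t$. Then there is a constant $M_0=M_0(H,\mathrm{Lip}(g))>0$, independent of $\Omega$, $b$, $\varepsilon$, $t$, $x$ and $\tau$, such that every minimizing curve, i.e. every absolutely continuous $\gamma:[\tau/\varepsilon,t/\varepsilon]\to\overline\Omega$, $\tau\in[0,t)$, with $\gamma(t/\varepsilon)=x/\varepsilon$, $(\gamma(\tau/\varepsilon),\tau)\in\partial Q_t$ and $$u^\varepsilon(x,t)=\varepsilon\int_{\tau/\varepsilon}^{t/\varepsilon}L(\gamma,\dot\gamma)\,ds+f_\varepsilon\big(\varepsilon\gamma(\tfrac\tau\varepsilon),\tau\big),$$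 satisfies $|\dot\gamma(s)|\le M_0$ for a.e. $s\in[\tau/\varepsilon,t/\varepsilon]$. Moreover, on the class of Hamiltonians normalized by $\tfrac{|p|^2}2-K_0\le H(y,p)\le\tfrac{|p|^2}2+K_0$ for all $y,p$, the constant can be chosen to depend only on $K_0$ and $\mathrm{Lip}(g)$; in particular it depends neither on $n$ nor on $\partial\Omega$. -/

import Mathlib

open MeasureTheory Set Filter Topology
open scoped NNReal ENNReal Pointwise

noncomputable section

/-- Euclidean space `ℝⁿ`. -/
abbrev Rn (n : ℕ) : Type := EuclideanSpace ℝ (Fin n)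

/-- The integer vector `k ∈ ℤⁿ`, seen in `ℝⁿ`. -/
def latticeVec {n : ℕ} (k : Fin n → ℤ) : Rn n :=
  WithLp.toLp 2 (fun i => (k i : ℝ))

/-- `∂Ω` is of class `C¹`: near each boundary point, `Ω` is the sublevel set `{ρ < 0}` of a
`C¹` function with non-vanishing gradient. -/
def HasC1Boundary {n : ℕ} (Ω : Set (Rn n)) : Prop :=
  ∀ x₀ ∈ frontier Ω, ∃ (U : Set (Rn n)) (ρ : Rn n → ℝ),
    IsOpen U ∧ x₀ ∈ U ∧ ContDiffOn ℝ 1 ρ U ∧ (∀ x ∈ U, fderiv ℝ ρ x ≠ 0) ∧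
      Ω ∩ U = {x | ρ x < 0} ∩ U

/-- The standing assumptions on `Ω ⊆ ℝⁿ`: open, connected, `Ω + ℤⁿ = Ω`, with `C¹` boundary. -/
structure IsPerforatedDomain {n : ℕ} (Ω : Set (Rn n)) : Prop where
  isOpen : IsOpen Ω
  isConnected : IsConnected Ω
  periodic : Ω + range (latticeVec (n := n)) = Ω
  c1Boundary : HasC1Boundary Ω

/-- The assumptions on the Hamiltonian `H(y, p)`: continuity, `ℤⁿ`-periodicity in `y`, coercivity
in `p` uniformly in `y`, and convexity in `p`. -/
structure IsHamiltonian {n : ℕ} (H : Rn n → Rn n → ℝ) : Prop where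
  continuous : Continuous (fun z : Rn n × Rn n => H z.1 z.2)
  periodic : ∀ (k : Fin n → ℤ) (y p : Rn n), H (y + latticeVec k) p = H y p
  coercive :
    Tendsto (fun p : Rn n => ⨅ y : Rn n, (H y p : EReal)) (Bornology.cobounded (Rn n)) (𝓝 ⊤)
  convex : ∀ y : Rn n, ConvexOn ℝ univ (H y)

/-- The normalization `|p|²/2 - K₀ ≤ H(y, p) ≤ |p|²/2 + K₀`. -/
def HasQuadraticGrowth {n : ℕ} (H : Rn n → Rn n → ℝ) (K₀ : ℝ) : Prop :=
  ∀ y p : Rn n, ‖p‖ ^ 2 / 2 - K₀ ≤ H y p ∧ H y p ≤ ‖p‖ ^ 2 / 2 + K₀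

/-- The assumptions on the boundary cost: `b ∈ BUC(ℝⁿ × ∂Ω)`, and `b(x, ·)` is `ℤⁿ`-periodic.
Values of `b` off `ℝⁿ × ∂Ω` are irrelevant. -/
structure IsBoundaryCost {n : ℕ} (Ω : Set (Rn n)) (b : Rn n → Rn n → ℝ) : Prop where
  bounded : ∃ C : ℝ, ∀ x, ∀ y ∈ frontier Ω, |b x y| ≤ C
  uniformContinuousOn :
    UniformContinuousOn (fun z : Rn n × Rn n => b z.1 z.2) (univ ×ˢ frontier Ω)
  periodic : ∀ (k : Fin n → ℤ) (x : Rn n), ∀ y ∈ frontier Ω, b x (y + latticeVec k) = b x y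

/-- `b̄(x) = min_{z ∈ ∂Ω} b(x, z)` (equal to `⊤` if `∂Ω` is empty). -/
def bBar {n : ℕ} (Ω : Set (Rn n)) (b : Rn n → Rn n → ℝ) (x : Rn n) : EReal :=
  ⨅ z ∈ frontier Ω, (b x z : EReal)

/-- The assumptions on the initial cost: `g ∈ BUC(ℝⁿ) ∩ Lip(ℝⁿ)` and `g ≤ b̄`;
`Λ` bounds the Lipschitz constant of `g`. -/
structure IsInitialCost {n : ℕ} (Ω : Set (Rn n)) (b : Rn n → Rn n → ℝ) (g : Rn n → ℝ)
    (Λ : ℝ≥0) : Prop where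
  bounded : ∃ C : ℝ, ∀ x, |g x| ≤ C
  uniformContinuous : UniformContinuous g
  lipschitz : LipschitzWith Λ g
  le_bBar : ∀ x, (g x : EReal) ≤ bBar Ω b x

/-- The Legendre transform `L(y, v) = sup_p (p · v - H(y, p))`, which may take the value `⊤`. -/
def lagrangian {n : ℕ} (H : Rn n → Rn n → ℝ) (y v : Rn n) : EReal :=
  ⨆ p : Rn n, ((inner ℝ p v - H y p : ℝ) : EReal)

/-- The integral over `[a, b]` of an extended-real function, as the integral of its positive part
minus that of its negative part. (A Lagrangian is bounded below, so that for it the second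
integral is finite and the value `⊤` means that the running cost is infinite.) -/
def eintegral (F : ℝ → EReal) (a b : ℝ) : EReal :=
  ((∫⁻ s in Icc a b, (F s).toENNReal : ℝ≥0∞) : EReal) -
    ((∫⁻ s in Icc a b, (-F s).toENNReal : ℝ≥0∞) : EReal)

/-- `∂Q_T = (∂Ω × (0, T)) ∪ (closure Ω × {0})`. -/
def parabolicBoundary {n : ℕ} (Ω : Set (Rn n)) (T : ℝ) : Set (Rn n × ℝ) :=
  (frontier Ω ×ˢ Ioo 0 T) ∪ (closure Ω ×ˢ {0})

/-- `γ` is an absolutely continuous curve on `[a, T]` with values in `S` and `γ(T) = x`. -/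
def IsCurveTo {n : ℕ} (S : Set (Rn n)) (a T : ℝ) (x : Rn n) (γ : ℝ → Rn n) : Prop :=
  AbsolutelyContinuousOnInterval γ a T ∧ (∀ s ∈ Icc a T, γ s ∈ S) ∧ γ T = x

/-- `f_ε(x, t)`: equal to `g(x)` at `t = 0` and to `b(x, x/ε)` for `t > 0`. -/
def exitCost {n : ℕ} (b : Rn n → Rn n → ℝ) (g : Rn n → ℝ) (ε : ℝ) (x : Rn n) (t : ℝ) : ℝ :=
  if t = 0 then g x else b x (ε⁻¹ • x)

/-- The cost `ε ∫_{τ/ε}^{t/ε} L(γ, γ̇) ds + f_ε(ε γ(τ/ε), τ)` of `γ` with exit time `τ`. -/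
def controlCost {n : ℕ} (H : Rn n → Rn n → ℝ) (b : Rn n → Rn n → ℝ) (g : Rn n → ℝ)
    (ε t τ : ℝ) (γ : ℝ → Rn n) : EReal :=
  (ε : EReal) * eintegral (fun s => lagrangian H (γ s) (deriv γ s)) (τ / ε) (t / ε) +
    (exitCost b g ε (ε • γ (τ / ε)) τ : EReal)

/-- The optimal control formula for `u^ε(x, t)`, `t > 0`: the infimum of the cost over
`τ ∈ [0, t)` and the absolutely continuous curves `γ : [0, t/ε] → closure Ω` with
`γ(t/ε) = x/ε` and `(γ(τ/ε), τ) ∈ ∂Q_t`. -/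
def valueFunction {n : ℕ} (Ω : Set (Rn n)) (H : Rn n → Rn n → ℝ) (b : Rn n → Rn n → ℝ)
    (g : Rn n → ℝ) (ε : ℝ) (x : Rn n) (t : ℝ) : EReal :=
  sInf {c : EReal | ∃ τ ∈ Ico 0 t, ∃ γ : ℝ → Rn n,
    IsCurveTo (closure Ω) 0 (t / ε) (ε⁻¹ • x) γ ∧
      (γ (τ / ε), τ) ∈ parabolicBoundary Ω t ∧ c = controlCost H b g ε t τ γ}

/-- `γ : [τ/ε, t/ε] → closure Ω`, with exit time `τ ∈ [0, t)`, is a minimizing curve in the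
optimal control formula for `u^ε(x, t)`. -/
structure IsMinimizingCurve {n : ℕ} (Ω : Set (Rn n)) (H : Rn n → Rn n → ℝ)
    (b : Rn n → Rn n → ℝ) (g : Rn n → ℝ) (ε : ℝ) (x : Rn n) (t τ : ℝ) (γ : ℝ → Rn n) : Prop where
  mem_Ico : τ ∈ Ico 0 t
  isCurveTo : IsCurveTo (closure Ω) (τ / ε) (t / ε) (ε⁻¹ • x) γ
  mem_boundary : (γ (τ / ε), τ) ∈ parabolicBoundary Ω t
  minimal : valueFunction Ω H b g ε x t = controlCost H b g ε t τ γ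

/-- `M₀` bounds the speed of all minimizing curves, for the Hamiltonian `H` and all initial costs
with Lipschitz constant at most `Λ`; the domain, the boundary cost, `ε`, `t`, `x` and the exit
time are arbitrary. -/
def IsVelocityBound {n : ℕ} (H : Rn n → Rn n → ℝ) (Λ : ℝ≥0) (M₀ : ℝ) : Prop :=
  ∀ (Ω : Set (Rn n)) (b : Rn n → Rn n → ℝ) (g : Rn n → ℝ),
    IsPerforatedDomain Ω → IsBoundaryCost Ω b → IsInitialCost Ω b g Λ →
    ∀ (ε t : ℝ), 0 < ε → 0 < t → ∀ x ∈ closure (ε • Ω), ∀ (τ : ℝ) (γ : ℝ → Rn n),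
      IsMinimizingCurve Ω H b g ε x t τ γ →
        ∀ᵐ s ∂(volume.restrict (Icc (τ / ε) (t / ε))), ‖deriv γ s‖ ≤ M₀

end

/-! ### The Legendre transform -/

section Lagrangian

variable {n : ℕ} {H : Rn n → Rn n → ℝ}

/-! A minimizing curve is compared with the curve that runs through a short piece `[s₁, s₂]` at half
the speed. Such a competitor stays in `closure Ω`, so the geometry of `Ω` never enters. It needs the
extra time `h = s₂ - s₁`, and this is found at the start of the curve. If `τ > 0`, the competitor
leaves the same boundary point `h` earlier, at the same exit cost, since `b` does not depend on
time. If `τ = 0`, the first piece of duration `h` is dropped. The change of `g` is then at most `ε Λ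
|γ(h) - γ(0)|`, while the running cost saved on that piece is at least `ε (Λ |γ(h) - γ(0)| - U h)`,
where `U` bounds `H` on `|p| ≤ Λ` (`HasEIntegral.mul_norm_sub_le`).

In both cases minimality gives `∫ L(γ, γ̇) - U h ≤ 2 ∫ L(γ, γ̇/2)` over `[s₁, s₂]`
(`IsMinimizingCurve.integral_le_half_speed`). Lebesgue differentiation turns this into `L(γ, γ̇) - U
≤ 2 L(γ, γ̇/2)` a.e. On the other hand, coercivity forces `2 L(y, v/2) ≤ L(y, v) - (U + 1)` once
`|v|` is large (`lagrangian_half_le_of_lt_norm`), so large speeds occur only on a null set. The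
threshold involves only bounds on the growth of `H`, and these are explicit under the quadratic
normalization. -/

lemma le_lagrangian (H : Rn n → Rn n → ℝ) (y v p : Rn n) :
    ((inner ℝ p v - H y p : ℝ) : EReal) ≤ lagrangian H y v :=
  le_iSup (fun p : Rn n => ((inner ℝ p v - H y p : ℝ) : EReal)) p

lemma lagrangian_le {y v : Rn n} {c : ℝ} (h : ∀ p, inner ℝ p v - H y p ≤ c) :
    lagrangian H y v ≤ (c : EReal) :=
  iSup_le fun p => EReal.coe_le_coe_iff.2 (h p)

lemma inner_sub_le_of_lagrangian_le {y v : Rn n} {c : ℝ} (h : lagrangian H y v ≤ (c : EReal))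
    (p : Rn n) : inner ℝ p v - H y p ≤ c :=
  EReal.coe_le_coe_iff.1 ((le_lagrangian H y v p).trans h)

lemma lagrangian_ne_bot (H : Rn n → Rn n → ℝ) (y v : Rn n) : lagrangian H y v ≠ ⊥ :=
  ((EReal.bot_lt_coe _).trans_le (le_lagrangian H y v 0)).ne'

lemma exists_norm_le_inner_eq {r : ℝ} (hr : 0 ≤ r) (v : Rn n) :
    ∃ e : Rn n, ‖e‖ ≤ r ∧ inner ℝ e v = r * ‖v‖ := by
  refine ⟨(r * ‖v‖⁻¹) • v, ?_, ?_⟩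
  · rw [norm_smul, Real.norm_of_nonneg (by positivity), mul_assoc]
    exact mul_le_of_le_one_right hr inv_mul_le_one
  · rw [inner_smul_left, real_inner_self_eq_norm_sq]
    rcases eq_or_ne ‖v‖ 0 with h | h
    · simp [h]
    · simp only [map_mul, conj_trivial]
      field_simp

/-- A bound `H ≤ U` on the ball of radius `r` gives `L(y, v) ≥ r|v| - U`. -/
lemma mul_norm_sub_le_lagrangian {r U : ℝ} (hr : 0 ≤ r) (hU : ∀ y p, ‖p‖ ≤ r → H y p ≤ U)
    (y v : Rn n) : ((r * ‖v‖ - U : ℝ) : EReal) ≤ lagrangian H y v := by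
  obtain ⟨e, he, hev⟩ := exists_norm_le_inner_eq hr v
  refine le_trans (EReal.coe_le_coe_iff.2 ?_) (le_lagrangian H y v e)
  linarith [hU y e he]

/-- The supremum runs over uncountably many `p`, so measurability goes through lower semicontinuity
of a supremum of continuous functions. -/
lemma measurable_lagrangian (hH : Continuous (fun z : Rn n × Rn n => H z.1 z.2)) :
    Measurable (fun z : Rn n × Rn n => lagrangian H z.1 z.2) := by
  refine LowerSemicontinuous.measurable (lowerSemicontinuous_iSup fun p => ?_)
  refine Continuous.lowerSemicontinuous (continuous_coe_real_ereal.comp ?_)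
  exact (continuous_const.inner continuous_snd).sub
    (hH.comp (continuous_fst.prodMk continuous_const))

/-- Halving the velocity costs a bounded amount. -/
lemma lagrangian_half_le {m c : ℝ} (hm : ∀ y p, -m ≤ H y p) {y v : Rn n}
    (h : lagrangian H y v ≤ (c : EReal)) :
    lagrangian H y ((1 / 2 : ℝ) • v) ≤ (((c + m) / 2 : ℝ) : EReal) := by
  refine lagrangian_le fun p => ?_
  have := inner_sub_le_of_lagrangian_le h p
  have := hm y p
  rw [real_inner_smul_right]
  linarith

/-- At large speed, covering the same distance at half the speed in twice the time saves at
least `U + 1`. -/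
lemma lagrangian_half_le_of_lt_norm {m U R V c : ℝ} (hR : 0 ≤ R)
    (hm : ∀ y p, -m ≤ H y p) (hHR : ∀ y p, H y p < U + 1 → ‖p‖ ≤ R)
    (hV : ∀ y p, ‖p‖ ≤ R + 1 → H y p ≤ V) {y v : Rn n}
    (hv : U + 1 + 2 * m + V < ‖v‖) (h : lagrangian H y v ≤ (c : EReal)) :
    lagrangian H y ((1 / 2 : ℝ) • v) ≤ (((c - (U + 1)) / 2 : ℝ) : EReal) := by
  refine lagrangian_le fun p => ?_
  rw [real_inner_smul_right]
  -- The quantity to bound is `p · v - 2 H(y, p)`. Where `H < U + 1`, it is at most `R|v| + 2m`,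
  -- while `L(y, v) ≥ (R + 1)|v| - V`; the spare `|v|` beats the constants. Where `H ≥ U + 1`, the
  -- second copy of `H` provides the gain.
  rcases lt_or_ge (H y p) (U + 1) with hp | hp
  · have h1 : inner ℝ p v ≤ R * ‖v‖ :=
      (real_inner_le_norm p v).trans (by gcongr; exact hHR y p hp)
    have h2 := EReal.coe_le_coe_iff.1
      ((mul_norm_sub_le_lagrangian (by linarith) hV y v).trans h)
    have := hm y p
    linarith
  · have := inner_sub_le_of_lagrangian_le h p
    linarith

end Lagrangian

/-! ### Integrals of extended-real functions -/

/-- `F` is a.e. finite and integrable on `[a, b]`, with integral `v`. -/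
structure HasEIntegral (F : ℝ → EReal) (a b v : ℝ) : Prop where
  ae_eq : ∀ᵐ s, s ∈ Ioo a b → F s = ((F s).toReal : EReal)
  intervalIntegrable : IntervalIntegrable (fun s => (F s).toReal) volume a b
  integral_eq : ∫ s in a..b, (F s).toReal = v

namespace HasEIntegral

variable {F G : ℝ → EReal} {a b c v w : ℝ}

/-- Agreement on the open interval suffices, so the kinks of a slowed curve at the ends of its
pieces play no role. -/
lemma congr (h : HasEIntegral F a b v) (hab : a ≤ b) (hFG : ∀ s ∈ Ioo a b, G s = F s) :
    HasEIntegral G a b v where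
  ae_eq := by
    filter_upwards [h.ae_eq] with s hs hmem
    rw [hFG s hmem]; exact hs hmem
  intervalIntegrable := by
    refine h.intervalIntegrable.congr_uIoo ?_
    intro s hs
    rw [uIoo_of_le hab] at hs
    simp only [hFG s hs]
  integral_eq := by
    rw [← h.integral_eq]
    refine intervalIntegral.integral_congr_uIoo ?_
    intro s hs
    rw [uIoo_of_le hab] at hs
    simp only [hFG s hs]

lemma trans (h : HasEIntegral F a b v) (h' : HasEIntegral F b c w) :
    HasEIntegral F a c (v + w) where
  ae_eq := by
    have hb : ∀ᵐ s : ℝ, s ≠ b := by simp [ae_iff, measure_singleton]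
    filter_upwards [h.ae_eq, h'.ae_eq, hb] with s hs hs' hsb hmem
    rcases lt_or_gt_of_ne hsb with hlt | hgt
    · exact hs ⟨hmem.1, hlt⟩
    · exact hs' ⟨hgt, hmem.2⟩
  intervalIntegrable := h.intervalIntegrable.trans h'.intervalIntegrable
  integral_eq := by
    rw [← intervalIntegral.integral_add_adjacent_intervals h.intervalIntegrable
      h'.intervalIntegrable, h.integral_eq, h'.integral_eq]

lemma mono (h : HasEIntegral F a b v) {c d : ℝ} (hac : a ≤ c) (hcd : c ≤ d) (hdb : d ≤ b) :
    HasEIntegral F c d (∫ s in c..d, (F s).toReal) where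
  ae_eq := by
    filter_upwards [h.ae_eq] with s hs hmem
    exact hs ⟨hac.trans_lt hmem.1, hmem.2.trans_le hdb⟩
  intervalIntegrable := by
    refine h.intervalIntegrable.mono_set ?_
    rw [uIcc_of_le hcd, uIcc_of_le (hac.trans (hcd.trans hdb))]
    exact Icc_subset_Icc hac hdb
  integral_eq := rfl

lemma comp_mul_add {k d : ℝ} (hk : 0 < k) (h : HasEIntegral F (k * a + d) (k * b + d) v) :
    HasEIntegral (fun s => F (k * s + d)) a b (k⁻¹ * v) where
  ae_eq := by
    have h0 : volume {s | ¬ (s ∈ Ioo (k * a + d) (k * b + d) → F s = ((F s).toReal : EReal))} = 0 :=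
      h.ae_eq
    have h1 : volume ((k * ·) ⁻¹' ((· + d) ⁻¹'
        {s | ¬ (s ∈ Ioo (k * a + d) (k * b + d) → F s = ((F s).toReal : EReal))})) = 0 := by
      rw [Real.volume_preimage_mul_left hk.ne', measure_preimage_add_right, h0, mul_zero]
    filter_upwards [compl_mem_ae_iff.2 h1] with s hs hmem
    simp only [mem_compl_iff, mem_preimage, mem_ofPred_eq, not_not] at hs
    exact hs ⟨by nlinarith [hmem.1], by nlinarith [hmem.2]⟩
  intervalIntegrable := by
    have h1 := (h.intervalIntegrable.comp_add_right d).comp_mul_left (c := k)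
    simpa [hk.ne'] using h1
  integral_eq := by
    rw [intervalIntegral.integral_comp_mul_add (fun s => (F s).toReal) hk.ne', h.integral_eq,
      smul_eq_mul]

lemma eintegral_eq (h : HasEIntegral F a b v) (hab : a ≤ b) : eintegral F a b = (v : EReal) := by
  have hae : ∀ᵐ s ∂volume.restrict (Icc a b), F s = ((F s).toReal : EReal) := by
    rw [← restrict_Ioo_eq_restrict_Icc, ae_restrict_iff' measurableSet_Ioo]
    exact h.ae_eq
  have hint : Integrable (fun s => (F s).toReal) (volume.restrict (Icc a b)) :=
    (intervalIntegrable_iff_integrableOn_Icc_of_le hab).1 h.intervalIntegrable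
  have h1 : ∫⁻ s in Icc a b, (F s).toENNReal = ∫⁻ s in Icc a b, ENNReal.ofReal (F s).toReal := by
    refine lintegral_congr_ae ?_
    filter_upwards [hae] with s hs
    conv_lhs => rw [hs]
    simp
  have h2 : ∫⁻ s in Icc a b, (-F s).toENNReal = ∫⁻ s in Icc a b, ENNReal.ofReal (-(F s).toReal) := by
    refine lintegral_congr_ae ?_
    filter_upwards [hae] with s hs
    conv_lhs => rw [hs, ← EReal.coe_neg]
    simp
  have h3 := integral_eq_lintegral_pos_part_sub_lintegral_neg_part hint
  have hp : ∫⁻ s in Icc a b, ENNReal.ofReal (F s).toReal ≠ ⊤ := hint.lintegral_lt_top.ne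
  have hn : ∫⁻ s in Icc a b, ENNReal.ofReal (-(F s).toReal) ≠ ⊤ := hint.neg.lintegral_lt_top.ne
  rw [← h.integral_eq, intervalIntegral.integral_of_le hab, ← integral_Icc_eq_integral_Ioc, h3,
    eintegral, h1, h2, EReal.coe_sub, EReal.coe_ennreal_toReal hp, EReal.coe_ennreal_toReal hn]

end HasEIntegral

/-- A measurable function which is bounded below and has integral `< ⊤` is integrable. -/
lemma hasEIntegral_of_eintegral_ne_top {F : ℝ → EReal} {a b U : ℝ} (hab : a ≤ b)
    (hF : AEMeasurable F (volume.restrict (Icc a b))) (hU : ∀ s, ((-U : ℝ) : EReal) ≤ F s)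
    (h : eintegral F a b ≠ ⊤) : HasEIntegral F a b (∫ s in a..b, (F s).toReal) := by
  have hneg : ∀ s, (-F s).toENNReal ≤ ENNReal.ofReal U := fun s => by
    have h1 : -F s ≤ (U : EReal) := by
      rw [EReal.neg_le, ← EReal.coe_neg]; exact hU s
    simpa using EReal.toENNReal_le_toENNReal h1
  have hN : ∫⁻ s in Icc a b, (-F s).toENNReal ≠ ⊤ := by
    refine ((lintegral_mono hneg).trans_lt ?_).ne
    rw [lintegral_const]
    exact ENNReal.mul_lt_top ENNReal.ofReal_lt_top (by simp)
  -- With a finite negative part, an infinite positive part would make `eintegral` equal to `⊤`.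
  have hP : ∫⁻ s in Icc a b, (F s).toENNReal ≠ ⊤ := by
    intro hP
    apply h
    rw [eintegral, hP, EReal.coe_ennreal_top, ← EReal.coe_ennreal_toReal hN]
    exact EReal.top_sub_coe _
  have hFP : AEMeasurable (fun s => (F s).toENNReal) (volume.restrict (Icc a b)) :=
    hF.ereal_toENNReal
  have hfin : ∀ᵐ s ∂volume.restrict (Icc a b), F s ≠ ⊤ := by
    filter_upwards [ae_lt_top' hFP hP] with s hs hs'
    simp [hs'] at hs
  have hbot : ∀ s, F s ≠ ⊥ := fun s => ((EReal.bot_lt_coe _).trans_le (hU s)).ne'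
  refine ⟨?_, ?_, rfl⟩
  · rw [← restrict_Ioo_eq_restrict_Icc, ae_restrict_iff' measurableSet_Ioo] at hfin
    filter_upwards [hfin] with s hs hmem
    exact (EReal.coe_toReal (hs hmem) (hbot s)).symm
  · rw [intervalIntegrable_iff_integrableOn_Icc_of_le hab]
    refine ⟨hF.ereal_toReal.aestronglyMeasurable, ?_⟩
    rw [hasFiniteIntegral_iff_enorm]
    refine lt_of_le_of_lt (lintegral_mono_ae (g := fun s => (F s).toENNReal + (-F s).toENNReal)
      ?_) ?_
    · filter_upwards [hfin] with s hs
      lift F s to ℝ using ⟨hs, hbot s⟩ with f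
      rw [← EReal.coe_neg]
      simp only [EReal.toReal_coe, EReal.real_coe_toENNReal]
      rw [← ofReal_norm, Real.norm_eq_abs]
      rcases abs_cases f with ⟨h1, _⟩ | ⟨h1, _⟩ <;> rw [h1]
      · exact le_self_add
      · exact le_add_self
    · rw [lintegral_add_left' hFP]
      exact ENNReal.add_lt_top.2 ⟨hP.lt_top, hN.lt_top⟩

/-! ### Absolutely continuous curves -/

/-- A monotone map keeps disjoint intervals disjoint, and a 1-Lipschitz map does not lengthen them,
so the same `δ` works. -/
lemma AbsolutelyContinuousOnInterval.comp_monotone_lipschitz {X : Type*} [PseudoMetricSpace X]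
    {f : ℝ → X} {a b c d : ℝ} {φ : ℝ → ℝ} (hf : AbsolutelyContinuousOnInterval f a b)
    (hφ : Monotone φ) (hL : LipschitzWith 1 φ) (hmaps : ∀ r ∈ uIcc c d, φ r ∈ uIcc a b) :
    AbsolutelyContinuousOnInterval (f ∘ φ) c d := by
  rw [absolutelyContinuousOnInterval_iff] at hf ⊢
  intro ε hε
  obtain ⟨δ, hδ, h⟩ := hf ε hε
  refine ⟨δ, hδ, fun E hE hlen => ?_⟩
  refine h (E.1, fun i => (φ (E.2 i).1, φ (E.2 i).2)) ⟨?_, ?_⟩ ?_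
  · exact fun i hi => ⟨hmaps _ (hE.1 i hi).1, hmaps _ (hE.1 i hi).2⟩
  · intro i hi j hj hij
    have hd := hE.2 hi hj hij
    simp only [Function.onFun, uIoc] at hd ⊢
    rw [Ioc_disjoint_Ioc] at hd ⊢
    simp only [← hφ.map_max, ← hφ.map_min]
    exact hφ hd
  · refine lt_of_le_of_lt (Finset.sum_le_sum fun i _ => ?_) hlen
    simpa using hL.dist_le_mul (E.2 i).1 (E.2 i).2

/-! ### The fundamental theorem of calculus for a scalar component of a curve. -/

section Inner

variable {n : ℕ} {γ : ℝ → Rn n} {a b : ℝ}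

lemma AbsolutelyContinuousOnInterval.const_inner (e : Rn n)
    (hγ : AbsolutelyContinuousOnInterval γ a b) :
    AbsolutelyContinuousOnInterval (fun s => inner ℝ e (γ s)) a b := by
  apply squeeze_zero (fun t ↦ ?_) (fun t ↦ ?_)
    (by simpa using Filter.Tendsto.const_mul ‖e‖ hγ)
  · exact Finset.sum_nonneg (fun i hi ↦ by positivity)
  · rw [Finset.mul_sum]
    refine Finset.sum_le_sum fun i _ => ?_
    rw [Real.dist_eq, ← inner_sub_right, dist_eq_norm]
    exact abs_real_inner_le_norm _ _

lemma AbsolutelyContinuousOnInterval.ae_deriv_const_inner (e : Rn n)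
    (hγ : AbsolutelyContinuousOnInterval γ a b) :
    ∀ᵐ s, s ∈ uIcc a b → deriv (fun s => inner ℝ e (γ s)) s = inner ℝ e (deriv γ s) := by
  filter_upwards [hγ.boundedVariationOn.ae_differentiableAt_of_mem_uIcc] with s hs hmem
  simpa using ((hasDerivAt_const s e).inner ℝ (hs hmem).hasDerivAt).deriv

lemma AbsolutelyContinuousOnInterval.intervalIntegrable_inner_deriv (e : Rn n)
    (hγ : AbsolutelyContinuousOnInterval γ a b) :
    IntervalIntegrable (fun s => inner ℝ e (deriv γ s)) volume a b := by
  refine (hγ.const_inner e).intervalIntegrable_deriv.congr_ae ?_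
  rw [EventuallyEq, ae_restrict_iff' measurableSet_uIoc]
  filter_upwards [hγ.ae_deriv_const_inner e] with s hs hmem
  exact hs (uIoc_subset_uIcc hmem)

lemma AbsolutelyContinuousOnInterval.integral_inner_deriv (e : Rn n)
    (hγ : AbsolutelyContinuousOnInterval γ a b) :
    ∫ s in a..b, inner ℝ e (deriv γ s) = inner ℝ e (γ b - γ a) := by
  rw [inner_sub_right, ← (hγ.const_inner e).integral_deriv_eq_sub]
  refine intervalIntegral.integral_congr_ae ?_
  filter_upwards [hγ.ae_deriv_const_inner e] with s hs hmem
  exact (hs (uIoc_subset_uIcc hmem)).symm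

end Inner

/-! ### Slowing a curve down -/

/-- The time change with slope `1/2` where its values lie in `[s₁, s₂]`, which is the identity
after `s₂`, a translation before, and is stopped at the value `c`. -/
noncomputable def slowTime (c s₁ s₂ r : ℝ) : ℝ :=
  max c (max r (min (r + (s₂ - s₁)) ((s₂ + r) / 2)))

section SlowTime

variable {c s₁ s₂ r T : ℝ}

lemma slowTime_of_le (hs : s₁ ≤ s₂) (h : r ≤ c - (s₂ - s₁)) :
    slowTime c s₁ s₂ r = c :=
  max_eq_left (max_le (by linarith) ((min_le_left _ _).trans (by linarith)))

lemma slowTime_of_mem_left (hs : s₁ ≤ s₂) (h : c - (s₂ - s₁) ≤ r) (h' : r ≤ s₁ - (s₂ - s₁)) :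
    slowTime c s₁ s₂ r = r + (s₂ - s₁) := by
  rw [slowTime, min_eq_left (by linarith), max_eq_right (a := r) (by linarith),
    max_eq_right (by linarith)]

lemma slowTime_of_mem_middle (hc : c ≤ s₁) (h : s₁ - (s₂ - s₁) ≤ r) (h' : r ≤ s₂) :
    slowTime c s₁ s₂ r = (1 / 2) * r + s₂ / 2 := by
  rw [slowTime, min_eq_right (by linarith), max_eq_right (a := r) (by linarith),
    max_eq_right (by linarith)]
  ring

lemma slowTime_of_ge (hc : c ≤ s₁) (hs : s₁ ≤ s₂) (h : s₂ ≤ r) : slowTime c s₁ s₂ r = r := by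
  rw [slowTime, min_eq_right (by linarith), max_eq_left (a := r) (by linarith),
    max_eq_right (by linarith)]

lemma monotone_slowTime : Monotone (slowTime c s₁ s₂) := by
  intro x y hxy
  unfold slowTime
  gcongr

/-- The time change is a lattice combination of affine maps of slopes `0`, `1/2` and `1`, and `max`
and `min` preserve the constant `1`. -/
lemma lipschitzWith_slowTime : LipschitzWith 1 (slowTime c s₁ s₂) := by
  have h1 : LipschitzWith 1 (fun r : ℝ => r + (s₂ - s₁)) :=
    LipschitzWith.of_dist_le_mul fun x y => by simp
  have h2 : LipschitzWith 1 (fun r : ℝ => (s₂ + r) / 2) :=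
    LipschitzWith.of_dist_le_mul fun x y => by
      rw [Real.dist_eq, Real.dist_eq, show (s₂ + x) / 2 - (s₂ + y) / 2 = (x - y) / 2 by ring,
        abs_div, abs_two]
      have := abs_nonneg (x - y)
      simp only [NNReal.coe_one]
      linarith
  have h3 := (LipschitzWith.id.max (h1.min h2)).const_max c
  simpa [slowTime, Function.comp_def] using! h3

lemma le_slowTime : c ≤ slowTime c s₁ s₂ r := le_max_left _ _

lemma slowTime_le (hc : c ≤ s₁) (hs : s₁ ≤ s₂) (hT : s₂ ≤ T) (hr : r ≤ T) :
    slowTime c s₁ s₂ r ≤ T :=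
  (monotone_slowTime hr).trans (slowTime_of_ge hc hs hT).le

end SlowTime

/-- The running cost of a slowed down curve. -/
lemma HasEIntegral.comp_slowTime {n : ℕ} {H : Rn n → Rn n → ℝ} {γ : ℝ → Rn n}
    {a c s₁ s₂ T v w : ℝ} (hac : a ≤ c) (hc : c ≤ s₁) (hs : s₁ ≤ s₂) (hT : s₂ ≤ T)
    (hF : HasEIntegral (fun s => lagrangian H (γ s) (deriv γ s)) a T v)
    (hG : HasEIntegral (fun s => lagrangian H (γ s) ((1 / 2 : ℝ) • deriv γ s)) a T w) :
    HasEIntegral (fun r => lagrangian H ((γ ∘ slowTime c s₁ s₂) r)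
      (deriv (γ ∘ slowTime c s₁ s₂) r)) (c - (s₂ - s₁)) T
      ((∫ s in c..s₁, (lagrangian H (γ s) (deriv γ s)).toReal) +
        2 * (∫ s in s₁..s₂, (lagrangian H (γ s) ((1 / 2 : ℝ) • deriv γ s)).toReal) +
        ∫ s in s₂..T, (lagrangian H (γ s) (deriv γ s)).toReal) := by
  -- Inside each piece the time change coincides near `r` with an affine map `ψ`, so the derivative
  -- is that of `γ ∘ ψ`.
  have key : ∀ {A B : ℝ} {ψ : ℝ → ℝ}, (∀ r ∈ Icc A B, slowTime c s₁ s₂ r = ψ r) →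
      ∀ r ∈ Ioo A B, lagrangian H ((γ ∘ slowTime c s₁ s₂) r) (deriv (γ ∘ slowTime c s₁ s₂) r) =
        lagrangian H (γ (ψ r)) (deriv (fun r => γ (ψ r)) r) := by
    intro A B ψ h r hr
    have he : (γ ∘ slowTime c s₁ s₂) =ᶠ[𝓝 r] fun r => γ (ψ r) := by
      filter_upwards [Ioo_mem_nhds hr.1 hr.2] with x hx
      simp [h x (Ioo_subset_Icc_self hx)]
    rw [he.deriv_eq, he.eq_of_nhds]
  have h1 : HasEIntegral (fun r => lagrangian H ((γ ∘ slowTime c s₁ s₂) r)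
      (deriv (γ ∘ slowTime c s₁ s₂) r)) (c - (s₂ - s₁)) (s₁ - (s₂ - s₁))
      (∫ s in c..s₁, (lagrangian H (γ s) (deriv γ s)).toReal) := by
    have h := (hF.mono hac hc (hs.trans hT))
    have h' := HasEIntegral.comp_mul_add (k := 1) (d := s₂ - s₁) (a := c - (s₂ - s₁))
      (b := s₁ - (s₂ - s₁)) one_pos (by simpa using! h)
    simp only [inv_one, one_mul] at h'
    refine h'.congr (by linarith) fun r hr => ?_
    rw [key (fun x hx => slowTime_of_mem_left hs hx.1 hx.2) r hr, deriv_comp_add_const]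
  have h2 : HasEIntegral (fun r => lagrangian H ((γ ∘ slowTime c s₁ s₂) r)
      (deriv (γ ∘ slowTime c s₁ s₂) r)) (s₁ - (s₂ - s₁)) s₂
      (2 * ∫ s in s₁..s₂, (lagrangian H (γ s) ((1 / 2 : ℝ) • deriv γ s)).toReal) := by
    have h := (hG.mono (hac.trans hc) hs hT)
    have e1 : (1 / 2 : ℝ) * (s₁ - (s₂ - s₁)) + s₂ / 2 = s₁ := by ring
    have e2 : (1 / 2 : ℝ) * s₂ + s₂ / 2 = s₂ := by ring
    have h' := HasEIntegral.comp_mul_add (k := 1 / 2) (d := s₂ / 2) (a := s₁ - (s₂ - s₁))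
      (b := s₂) (by norm_num) (by rw [e1, e2]; exact h)
    have e3 : ((1 / 2 : ℝ))⁻¹ = 2 := by norm_num
    rw [e3] at h'
    refine h'.congr (by linarith) fun r hr => ?_
    rw [key (fun x hx => slowTime_of_mem_middle hc hx.1 hx.2) r hr,
      deriv_comp_mul_left (1 / 2 : ℝ) (fun x => γ (x + s₂ / 2)) r, deriv_comp_add_const]
  have h3 : HasEIntegral (fun r => lagrangian H ((γ ∘ slowTime c s₁ s₂) r)
      (deriv (γ ∘ slowTime c s₁ s₂) r)) s₂ T
      (∫ s in s₂..T, (lagrangian H (γ s) (deriv γ s)).toReal) := by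
    refine (hF.mono (hac.trans (hc.trans hs)) hT le_rfl).congr hT fun r hr => ?_
    rw [key (ψ := fun x => x) (fun x hx => slowTime_of_ge hc hs hx.1) r hr]
  exact (h1.trans h2).trans h3

/-! ### The speed of minimizing curves -/

section RunningCost

variable {n : ℕ} {H : Rn n → Rn n → ℝ} {γ : ℝ → Rn n} {a T : ℝ}

lemma aemeasurable_lagrangian_smul_deriv (hH : Continuous (fun z : Rn n × Rn n => H z.1 z.2))
    (hγ : ContinuousOn γ (Icc a T)) (k : ℝ) :
    AEMeasurable (fun s => lagrangian H (γ s) (k • deriv γ s)) (volume.restrict (Icc a T)) := by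
  have h1 : AEMeasurable γ (volume.restrict (Icc a T)) := hγ.aemeasurable measurableSet_Icc
  have h2 : Measurable (fun s => k • deriv γ s) := (measurable_deriv γ).const_smul k
  exact Measurable.comp_aemeasurable (f := fun s => (γ s, k • deriv γ s))
    (measurable_lagrangian hH) (h1.prodMk h2.aemeasurable)

lemma neg_le_lagrangian {r U : ℝ} (hr : 0 ≤ r) (hU : ∀ y p, ‖p‖ ≤ r → H y p ≤ U)
    (y v : Rn n) : ((-U : ℝ) : EReal) ≤ lagrangian H y v := by
  refine le_trans (EReal.coe_le_coe_iff.2 ?_) (mul_norm_sub_le_lagrangian hr hU y v)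
  have : 0 ≤ r * ‖v‖ := by positivity
  linarith

/-- If a curve has finite running cost, so does the same curve run through at half the speed. -/
lemma HasEIntegral.half_speed {m r U v : ℝ} (haT : a ≤ T)
    (hH : Continuous (fun z : Rn n × Rn n => H z.1 z.2)) (hm : ∀ y p, -m ≤ H y p)
    (hr : 0 ≤ r) (hU : ∀ y p, ‖p‖ ≤ r → H y p ≤ U) (hγ : ContinuousOn γ (Icc a T))
    (hF : HasEIntegral (fun s => lagrangian H (γ s) (deriv γ s)) a T v) :
    HasEIntegral (fun s => lagrangian H (γ s) ((1 / 2 : ℝ) • deriv γ s)) a T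
      (∫ s in a..T, (lagrangian H (γ s) ((1 / 2 : ℝ) • deriv γ s)).toReal) := by
  have hle : ∀ᵐ s, s ∈ Ioo a T → lagrangian H (γ s) ((1 / 2 : ℝ) • deriv γ s) ≤
      ((((lagrangian H (γ s) (deriv γ s)).toReal + m) / 2 : ℝ) : EReal) := by
    filter_upwards [hF.ae_eq] with s hs hmem
    exact lagrangian_half_le hm (hs hmem).le
  have hfin : ∀ᵐ s, s ∈ Ioo a T → lagrangian H (γ s) ((1 / 2 : ℝ) • deriv γ s) =
      ((lagrangian H (γ s) ((1 / 2 : ℝ) • deriv γ s)).toReal : EReal) := by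
    filter_upwards [hle] with s hs hmem
    exact (EReal.coe_toReal ((hs hmem).trans_lt (EReal.coe_lt_top _)).ne
      (lagrangian_ne_bot _ _ _)).symm
  refine ⟨hfin, ?_, rfl⟩
  -- Dominating function for `-U ≤ L(γ, γ̇/2) ≤ (L(γ, γ̇) + m)/2`.
  have hb : IntervalIntegrable
      (fun s => |(lagrangian H (γ s) (deriv γ s)).toReal| + (|m| + |U|)) volume a T :=
    hF.intervalIntegrable.abs.add intervalIntegrable_const
  rw [intervalIntegrable_iff_integrableOn_Icc_of_le haT] at hb ⊢
  refine Integrable.mono' hb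
    (aemeasurable_lagrangian_smul_deriv hH hγ _).ereal_toReal.aestronglyMeasurable ?_
  rw [← restrict_Ioo_eq_restrict_Icc, ae_restrict_iff' measurableSet_Ioo]
  filter_upwards [hle, hfin] with s hs hs' hmem
  have h1 := hs hmem
  have h2 := neg_le_lagrangian hr hU (γ s) ((1 / 2 : ℝ) • deriv γ s)
  rw [hs' hmem, EReal.coe_le_coe_iff] at h1 h2
  rw [Real.norm_eq_abs, abs_le]
  have := neg_abs_le (lagrangian H (γ s) (deriv γ s)).toReal
  have := le_abs_self (lagrangian H (γ s) (deriv γ s)).toReal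
  have := abs_nonneg (lagrangian H (γ s) (deriv γ s)).toReal
  have := le_abs_self U
  have := le_abs_self m
  have := abs_nonneg m
  have := abs_nonneg U
  constructor <;> linarith

/-- The running cost controls the distance between the end points. -/
lemma HasEIntegral.mul_norm_sub_le {r U v : ℝ} (haT : a ≤ T) (hr : 0 ≤ r)
    (hU : ∀ y p, ‖p‖ ≤ r → H y p ≤ U) (hγ : AbsolutelyContinuousOnInterval γ a T)
    (hF : HasEIntegral (fun s => lagrangian H (γ s) (deriv γ s)) a T v) :
    r * ‖γ T - γ a‖ - U * (T - a) ≤ v := by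
  -- Testing `L` with one fixed `e` parallel to the displacement gives `L(γ, γ̇) ≥ e · γ̇ - U`,
  -- whose right-hand side integrates exactly.
  obtain ⟨e, hen, h2⟩ := exists_norm_le_inner_eq hr (γ T - γ a)
  have hint : IntervalIntegrable (fun s => inner ℝ e (deriv γ s) - U) volume a T :=
    (hγ.intervalIntegrable_inner_deriv e).sub intervalIntegrable_const
  have hI : ∫ s in a..T, (inner ℝ e (deriv γ s) - U) = r * ‖γ T - γ a‖ - U * (T - a) := by
    rw [intervalIntegral.integral_sub (hγ.intervalIntegrable_inner_deriv e)
      intervalIntegrable_const, hγ.integral_inner_deriv, intervalIntegral.integral_const, h2,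
      smul_eq_mul, mul_comm U]
  rw [← hI, ← hF.integral_eq]
  refine intervalIntegral.integral_mono_ae_restrict haT hint hF.intervalIntegrable ?_
  rw [← restrict_Ioo_eq_restrict_Icc, EventuallyLE, ae_restrict_iff' measurableSet_Ioo]
  filter_upwards [hF.ae_eq] with s hs hmem
  have h3 := le_lagrangian H (γ s) (deriv γ s) e
  rw [hs hmem, EReal.coe_le_coe_iff] at h3
  linarith [hU (γ s) e hen]

end RunningCost

/-! ### Competitors of a minimizing curve. -/

section Minimizing

variable {n : ℕ} {Ω : Set (Rn n)} {H b : Rn n → Rn n → ℝ} {g : Rn n → ℝ} {ε t τ : ℝ} {x : Rn n}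
  {γ : ℝ → Rn n}

lemma HasEIntegral.controlCost_eq {v : ℝ} (h : τ / ε ≤ t / ε)
    (hF : HasEIntegral (fun s => lagrangian H (γ s) (deriv γ s)) (τ / ε) (t / ε) v) :
    controlCost H b g ε t τ γ = ((ε * v + exitCost b g ε (ε • γ (τ / ε)) τ : ℝ) : EReal) := by
  rw [controlCost, hF.eintegral_eq h, EReal.coe_add, EReal.coe_mul]

/-- Staying at `x` has finite cost. -/
lemma valueFunction_ne_top {m : ℝ} (hm : ∀ y p, -m ≤ H y p) (hε : 0 < ε) (ht : 0 < t)
    (hx : ε⁻¹ • x ∈ closure Ω) : valueFunction Ω H b g ε x t ≠ ⊤ := by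
  have hT : (0 : ℝ) / ε ≤ t / ε := by gcongr
  set y := ε⁻¹ • x
  have hL : lagrangian H y 0 = ((lagrangian H y 0).toReal : EReal) := by
    refine (EReal.coe_toReal ((lagrangian_le (c := m) fun p => ?_).trans_lt
      (EReal.coe_lt_top _)).ne (lagrangian_ne_bot _ _ _)).symm
    rw [inner_zero_right]
    linarith [hm y p]
  have hF : HasEIntegral (fun s => lagrangian H ((fun _ : ℝ => y) s) (deriv (fun _ : ℝ => y) s))
      (0 / ε) (t / ε) (∫ _ in (0 / ε)..(t / ε), (lagrangian H y 0).toReal) := by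
    refine ⟨?_, ?_, ?_⟩
    · filter_upwards with s _
      rw [deriv_const]
      exact hL
    · simp
    · simp
  have hle : valueFunction Ω H b g ε x t ≤ controlCost H b g ε t 0 (fun _ => y) :=
    sInf_le ⟨0, ⟨le_rfl, ht⟩, fun _ => y,
      ⟨((LipschitzWith.const y).lipschitzOnWith).absolutelyContinuousOnInterval,
        fun _ _ => hx, rfl⟩, Or.inr ⟨hx, rfl⟩, rfl⟩
  rw [hF.controlCost_eq hT] at hle
  exact (hle.trans_lt (EReal.coe_lt_top _)).ne

namespace IsMinimizingCurve

lemma div_lt_div (hγ : IsMinimizingCurve Ω H b g ε x t τ γ) (hε : 0 < ε) : τ / ε < t / ε :=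
  div_lt_div_of_pos_right hγ.mem_Ico.2 hε

lemma continuousOn (hγ : IsMinimizingCurve Ω H b g ε x t τ γ) (hε : 0 < ε) :
    ContinuousOn γ (Icc (τ / ε) (t / ε)) := by
  have := hγ.isCurveTo.1.continuousOn
  rwa [uIcc_of_le (hγ.div_lt_div hε).le] at this

/-- The running cost of a minimizing curve is finite. -/
lemma hasEIntegral {m r U : ℝ} (hγ : IsMinimizingCurve Ω H b g ε x t τ γ) (hε : 0 < ε)
    (hH : Continuous (fun z : Rn n × Rn n => H z.1 z.2)) (hm : ∀ y p, -m ≤ H y p)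
    (hr : 0 ≤ r) (hU : ∀ y p, ‖p‖ ≤ r → H y p ≤ U) :
    HasEIntegral (fun s => lagrangian H (γ s) (deriv γ s)) (τ / ε) (t / ε)
      (∫ s in (τ / ε)..(t / ε), (lagrangian H (γ s) (deriv γ s)).toReal) := by
  have hT := hγ.div_lt_div hε
  refine hasEIntegral_of_eintegral_ne_top hT.le ?_ (fun s => neg_le_lagrangian hr hU _ _) ?_
  · simpa using aemeasurable_lagrangian_smul_deriv hH (hγ.continuousOn hε) 1
  · intro htop
    have hx : ε⁻¹ • x ∈ closure Ω := by
      rw [← hγ.isCurveTo.2.2]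
      exact hγ.isCurveTo.2.1 _ (right_mem_Icc.2 hT.le)
    apply valueFunction_ne_top (b := b) (g := g) hm hε (hγ.mem_Ico.1.trans_lt hγ.mem_Ico.2) hx
    rw [hγ.minimal, controlCost, htop, EReal.coe_mul_top_of_pos hε]
    exact EReal.top_add_coe _

/-- Comparison of a minimizing curve with the curve that drops its initial part up to time `c` and
is slowed down over `[s₁, s₂]`. -/
lemma le_slowed {c s₁ s₂ v w e : ℝ} (hγ : IsMinimizingCurve Ω H b g ε x t τ γ) (hε : 0 < ε)
    (hac : τ / ε ≤ c) (hc : c ≤ s₁) (hs : s₁ ≤ s₂) (hT : s₂ ≤ t / ε) (hsc : s₂ - s₁ ≤ c)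
    (hcT : c - (s₂ - s₁) < t / ε)
    (hF : HasEIntegral (fun s => lagrangian H (γ s) (deriv γ s)) (τ / ε) (t / ε) v)
    (hG : HasEIntegral (fun s => lagrangian H (γ s) ((1 / 2 : ℝ) • deriv γ s))
      (τ / ε) (t / ε) w)
    (hmem : (γ c, ε * (c - (s₂ - s₁))) ∈ parabolicBoundary Ω t)
    (he : exitCost b g ε (ε • γ c) (ε * (c - (s₂ - s₁))) ≤
      exitCost b g ε (ε • γ (τ / ε)) τ + ε * e) :
    (∫ s in (τ / ε)..c, (lagrangian H (γ s) (deriv γ s)).toReal) - e +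
      (∫ s in s₁..s₂, (lagrangian H (γ s) (deriv γ s)).toReal) ≤
      2 * ∫ s in s₁..s₂, (lagrangian H (γ s) ((1 / 2 : ℝ) • deriv γ s)).toReal := by
  have hdiv : ε * (c - (s₂ - s₁)) / ε = c - (s₂ - s₁) := by field_simp
  have hstart : slowTime c s₁ s₂ (c - (s₂ - s₁)) = c := slowTime_of_le hs le_rfl
  have haT := (hγ.div_lt_div hε).le
  have hnew := HasEIntegral.comp_slowTime hac hc hs hT hF hG
  -- Competitors must be defined on all of `[0, t/ε]`; before its exit time the slowed curve rests
  -- at `γ c`.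
  have hmaps : ∀ r ∈ Icc 0 (t / ε), slowTime c s₁ s₂ r ∈ Icc (τ / ε) (t / ε) := fun r hr =>
    ⟨hac.trans le_slowTime, slowTime_le hc hs hT hr.2⟩
  have ht0 : 0 ≤ t / ε := (sub_nonneg.2 hsc).trans hcT.le
  have hle : valueFunction Ω H b g ε x t ≤
      controlCost H b g ε t (ε * (c - (s₂ - s₁))) (γ ∘ slowTime c s₁ s₂) := by
    refine sInf_le ⟨_, ⟨mul_nonneg hε.le (sub_nonneg.2 hsc), ?_⟩, _, ⟨?_, ?_, ?_⟩, ?_, rfl⟩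
    · rw [lt_div_iff₀ hε] at hcT
      linarith
    · refine hγ.isCurveTo.1.comp_monotone_lipschitz monotone_slowTime lipschitzWith_slowTime ?_
      rwa [uIcc_of_le haT, uIcc_of_le ht0]
    · exact fun r hr => hγ.isCurveTo.2.1 _ (hmaps r hr)
    · rw [Function.comp_apply, slowTime_of_ge hc hs hT]
      exact hγ.isCurveTo.2.2
    · rwa [hdiv, Function.comp_apply, hstart]
  rw [hγ.minimal, hF.controlCost_eq haT,
    HasEIntegral.controlCost_eq (by rw [hdiv]; exact hcT.le) (by rw [hdiv]; exact hnew),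
    EReal.coe_le_coe_iff, hdiv, Function.comp_apply, hstart] at hle
  -- The costs over `[c, s₁]` and `[s₂, t/ε]` are common to both curves and cancel.
  have hsplit := ((hF.mono le_rfl hac (hc.trans (hs.trans hT))).trans
    ((hF.mono hac hc (hs.trans hT)).trans
      ((hF.mono (hac.trans hc) hs hT).trans
        (hF.mono (hac.trans (hc.trans hs)) hT le_rfl)))).integral_eq
  rw [hF.integral_eq] at hsplit
  rw [hsplit] at hle
  refine le_of_mul_le_mul_left ?_ hε
  linarith

/-- Slowing a minimizing curve down by the factor two over a short interval `[s₁, s₂]` saves at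
most `U (s₂ - s₁)`. -/
lemma integral_le_half_speed {Λ : ℝ≥0} {U v w s₁ s₂ : ℝ}
    (hγ : IsMinimizingCurve Ω H b g ε x t τ γ) (hε : 0 < ε) (hg : LipschitzWith Λ g) (hU0 : 0 ≤ U)
    (hU : ∀ y p, ‖p‖ ≤ Λ → H y p ≤ U)
    (hF : HasEIntegral (fun s => lagrangian H (γ s) (deriv γ s)) (τ / ε) (t / ε) v)
    (hG : HasEIntegral (fun s => lagrangian H (γ s) ((1 / 2 : ℝ) • deriv γ s))
      (τ / ε) (t / ε) w)
    (has : τ / ε < s₁) (hs : s₁ < s₂) (hT : s₂ < t / ε) (hs' : s₂ - s₁ < s₁)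
    (hsτ : 0 < τ → s₂ - s₁ < τ / ε) :
    (∫ s in s₁..s₂, (lagrangian H (γ s) (deriv γ s)).toReal) - U * (s₂ - s₁) ≤
      2 * ∫ s in s₁..s₂, (lagrangian H (γ s) ((1 / 2 : ℝ) • deriv γ s)).toReal := by
  -- For `τ = 0` no earlier start is possible: the cut is at `c = s₂ - s₁` and the competitor also
  -- starts at time `0`.
  rcases hγ.mem_Ico.1.eq_or_lt with h0 | hpos
  · subst h0
    rw [zero_div] at has
    have hc0 : (0 : ℝ) / ε ≤ s₂ - s₁ := by rw [zero_div]; linarith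
    have hcl : γ (s₂ - s₁) ∈ closure Ω := hγ.isCurveTo.2.1 _ ⟨hc0, by linarith⟩
    have hdist : (Λ : ℝ) * ‖γ (s₂ - s₁) - γ (0 / ε)‖ - U * (s₂ - s₁ - 0 / ε) ≤ _ :=
      (hF.mono le_rfl hc0 (by linarith)).mul_norm_sub_le hc0 Λ.2 hU (hγ.isCurveTo.1.mono (by
        rw [uIcc_of_le hc0, uIcc_of_le (by linarith)]
        exact Icc_subset_Icc_right (by linarith)))
    have h := hγ.le_slowed (e := Λ * ‖γ (s₂ - s₁) - γ (0 / ε)‖) hε hc0 hs'.le hs.le hT.le le_rfl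
      (by linarith) hF hG (Or.inr ⟨hcl, by simp⟩) (by
        simp only [sub_self, mul_zero, exitCost, if_true]
        have h1 := hg.dist_le_mul (ε • γ (s₂ - s₁)) (ε • γ (0 / ε))
        rw [Real.dist_eq, dist_eq_norm, ← smul_sub, norm_smul, Real.norm_of_nonneg hε.le] at h1
        have h2 := le_abs_self (g (ε • γ (s₂ - s₁)) - g (ε • γ (0 / ε)))
        linarith)
    rw [zero_div, sub_zero] at hdist
    rw [zero_div] at h
    linarith
  -- Nothing is dropped, `c = τ / ε`. The new exit time remains positive, so the exit cost is still
  -- `b` at the same point, and `e = 0`.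
  · have hsτ := hsτ hpos
    have hτε : ε * (τ / ε) = τ := by field_simp
    have hτ' : 0 < ε * (τ / ε - (s₂ - s₁)) := mul_pos hε (by linarith)
    have hlt : ε * (τ / ε - (s₂ - s₁)) < τ := by
      have : 0 < ε * (s₂ - s₁) := mul_pos hε (by linarith)
      linarith
    have hfr : γ (τ / ε) ∈ frontier Ω := by
      rcases hγ.mem_boundary with h | h
      · exact h.1
      · exact absurd h.2 hpos.ne'
    have h := hγ.le_slowed (e := 0) hε le_rfl has.le hs.le hT.le hsτ.le
      (by linarith) hF hG (Or.inl ⟨hfr, hτ', hlt.trans hγ.mem_Ico.2⟩) (by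
        simp only [exitCost, hτ'.ne', hpos.ne', if_false]
        linarith)
    have h0 : 0 ≤ U * (s₂ - s₁) := mul_nonneg hU0 (by linarith)
    simp only [intervalIntegral.integral_same] at h
    linarith

end IsMinimizingCurve

end Minimizing

/-- A function with nonnegative integrals over all short intervals to the right of each point is
nonnegative a.e. -/
lemma ae_nonneg_of_eventually_integral_nonneg {h : ℝ → ℝ} {a T : ℝ} (haT : a ≤ T)
    (hint : IntervalIntegrable h volume a T)
    (hpos : ∀ s ∈ Ioo a T, ∀ᶠ u in 𝓝[>] s, 0 ≤ ∫ r in s..u, h r) :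
    ∀ᵐ s, s ∈ Ioo a T → 0 ≤ h s := by
  -- At a Lebesgue point `h s` is the limit of the averages of `h` over `[s, u]`.
  filter_upwards [hint.ae_hasDerivAt_integral] with s hs hmem
  rw [uIcc_of_le haT] at hs
  have hd := hs (Ioo_subset_Icc_self hmem) s (Ioo_subset_Icc_self hmem)
  have hslope := (hasDerivWithinAt_iff_tendsto_slope'
    (notMem_Ioi.2 le_rfl)).1 (hd.hasDerivWithinAt (s := Ioi s))
  refine ge_of_tendsto hslope ?_
  filter_upwards [hpos s hmem, self_mem_nhdsWithin] with u hu hsu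
  rw [slope_def_field, intervalIntegral.integral_same, sub_zero]
  exact div_nonneg hu (sub_nonneg.2 (le_of_lt hsu))

/-- A speed bound in terms of the growth of the Hamiltonian. -/
theorem isVelocityBound_of_growth {n : ℕ} {H : Rn n → Rn n → ℝ} {Λ : ℝ≥0} {m U R V : ℝ}
    (hH : Continuous (fun z : Rn n × Rn n => H z.1 z.2)) (hU0 : 0 ≤ U) (hR : 0 ≤ R)
    (hm : ∀ y p, -m ≤ H y p) (hU : ∀ y p, ‖p‖ ≤ Λ → H y p ≤ U)
    (hHR : ∀ y p, H y p < U + 1 → ‖p‖ ≤ R) (hV : ∀ y p, ‖p‖ ≤ R + 1 → H y p ≤ V) :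
    IsVelocityBound H Λ (U + 1 + 2 * m + V) := by
  intro Ω b g _ _ hg ε t hε ht x _ τ γ hγ
  have haT := (hγ.div_lt_div hε).le
  have hF := hγ.hasEIntegral hε hH hm Λ.2 hU
  have hG := hF.half_speed haT hH hm Λ.2 hU (hγ.continuousOn hε)
  have hτ0 : 0 ≤ τ / ε := div_nonneg hγ.mem_Ico.1 hε.le
  have hnn := ae_nonneg_of_eventually_integral_nonneg (a := τ / ε) (T := t / ε)
    (h := fun s => 2 * (lagrangian H (γ s) ((1 / 2 : ℝ) • deriv γ s)).toReal -
      (lagrangian H (γ s) (deriv γ s)).toReal + U) haT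
    (((hG.intervalIntegrable.const_mul 2).sub hF.intervalIntegrable).add
      intervalIntegrable_const) (by
    intro s hs
    -- The admissible length of the slowed piece depends on `s` and on `τ`; only small `u - s`
    -- matters.
    have h1 : ∀ᶠ u in 𝓝[>] s, u < t / ε := nhdsWithin_le_nhds (Iio_mem_nhds hs.2)
    have h2 : ∀ᶠ u in 𝓝[>] s, u < s + s :=
      nhdsWithin_le_nhds (Iio_mem_nhds (by linarith [hs.1]))
    have h3 : ∀ᶠ u in 𝓝[>] s, 0 < τ → u < s + τ / ε := by
      by_cases hτ : 0 < τ
      · filter_upwards [nhdsWithin_le_nhds (Iio_mem_nhds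
          (show s < s + τ / ε by linarith [div_pos hτ hε]))] with u hu _ using hu
      · exact Eventually.of_forall fun u hu => absurd hu hτ
    filter_upwards [h1, h2, h3, self_mem_nhdsWithin] with u hu1 hu2 hu3 hsu
    rw [mem_Ioi] at hsu
    have hle := hγ.integral_le_half_speed hε hg.lipschitz hU0 hU hF hG hs.1 hsu hu1
      (by linarith) (fun hτ => by linarith [hu3 hτ])
    have hFi := (hF.mono hs.1.le hsu.le hu1.le).intervalIntegrable
    have hGi := (hG.mono hs.1.le hsu.le hu1.le).intervalIntegrable.const_mul 2
    rw [intervalIntegral.integral_add (hGi.sub hFi) intervalIntegrable_const,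
      intervalIntegral.integral_sub hGi hFi, intervalIntegral.integral_const_mul,
      intervalIntegral.integral_const, smul_eq_mul]
    linarith)
  rw [← restrict_Ioo_eq_restrict_Icc, ae_restrict_iff' measurableSet_Ioo]
  filter_upwards [hnn, hF.ae_eq, hG.ae_eq] with s hs hFs hGs hmem
  -- Large speed would give `2 L(γ, γ̇/2) - L(γ, γ̇) + U ≤ -1`.
  by_contra hlt
  have h := lagrangian_half_le_of_lt_norm hR hm hHR hV (not_le.1 hlt) (hFs hmem).le
  rw [hGs hmem, EReal.coe_le_coe_iff] at h
  linarith [hs hmem]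

/-! ### Growth of Hamiltonians -/

namespace IsHamiltonian

variable {n : ℕ} {H : Rn n → Rn n → ℝ}

/-- Every point has a lattice translate in the ball of radius `√n`. -/
lemma _root_.exists_latticeVec_norm_le (y : Rn n) : ∃ k : Fin n → ℤ, ‖y + latticeVec k‖ ≤ √n := by
  refine ⟨fun i => -⌊y i⌋, ?_⟩
  rw [EuclideanSpace.norm_eq]
  refine Real.sqrt_le_sqrt ?_
  have h : ∀ i ∈ Finset.univ, ‖(y + latticeVec fun i => -⌊y i⌋) i‖ ^ 2 ≤ 1 := by
    intro i _
    have h1 : (y + latticeVec fun i => -⌊y i⌋) i = Int.fract (y i) := by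
      simp [latticeVec, Int.fract, sub_eq_add_neg]
    rw [h1, Real.norm_of_nonneg (Int.fract_nonneg _)]
    exact pow_le_one₀ (Int.fract_nonneg _) (Int.fract_lt_one _).le
  simpa using Finset.sum_le_sum h

/-- By periodicity `y` may be taken in a fixed ball, where compactness applies. -/
lemma exists_abs_le (hH : IsHamiltonian H) (r : ℝ) :
    ∃ C, 0 ≤ C ∧ ∀ y p, ‖p‖ ≤ r → |H y p| ≤ C := by
  obtain ⟨C, hC⟩ := ((isCompact_closedBall (0 : Rn n) √n).prod
    (isCompact_closedBall (0 : Rn n) r)).exists_bound_of_continuousOn hH.continuous.continuousOn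
  refine ⟨max C 0, le_max_right _ _, fun y p hp => ?_⟩
  obtain ⟨k, hk⟩ := exists_latticeVec_norm_le y
  rw [← hH.periodic k y p]
  exact (hC (y + latticeVec k, p) ⟨by simpa using hk, by simpa using hp⟩).trans (le_max_left _ _)

lemma exists_norm_le (hH : IsHamiltonian H) (C : ℝ) :
    ∃ R, 0 ≤ R ∧ ∀ y p, H y p < C → ‖p‖ ≤ R := by
  have h := hH.coercive.eventually (lt_mem_nhds (EReal.coe_lt_top C))
  obtain ⟨R, -, hR⟩ := (hasBasis_cobounded_norm.eventually_iff).1 h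
  refine ⟨max R 0, le_max_right _ _, fun y p hp => ?_⟩
  by_contra hlt
  rw [not_le] at hlt
  have h1 : (C : EReal) < ⨅ y : Rn n, (H y p : EReal) := hR ((le_max_left _ _).trans hlt.le)
  exact absurd (EReal.coe_lt_coe_iff.1 (h1.trans_le (iInf_le _ y))) hp.not_gt

/-- By coercivity `H` can be negative only for `p` in a bounded set, where it is bounded. -/
lemma exists_neg_le (hH : IsHamiltonian H) : ∃ m, 0 ≤ m ∧ ∀ y p, -m ≤ H y p := by
  obtain ⟨R, -, hR⟩ := hH.exists_norm_le 0
  obtain ⟨C, hC0, hC⟩ := hH.exists_abs_le R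
  refine ⟨C, hC0, fun y p => ?_⟩
  rcases lt_or_ge (H y p) 0 with h | h
  · exact (abs_le.1 (hC y p (hR y p h))).1
  · linarith

end IsHamiltonian

/-- Under the standing assumptions, the speed of every minimizing curve is bounded by a constant
`M₀ = M₀(H, Lip(g))`; for `H` normalized by `|p|²/2 - K₀ ≤ H ≤ |p|²/2 + K₀`, it depends on `H` only
through `K₀`, and so not on the dimension `n` either. -/
theorem lemma2p6 :
    (∀ (n : ℕ) (H : Rn n → Rn n → ℝ), IsHamiltonian H →
      ∀ Λ : ℝ≥0, ∃ M₀ : ℝ, 0 < M₀ ∧ IsVelocityBound H Λ M₀) ∧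
    (∀ (K₀ : ℝ) (Λ : ℝ≥0), ∃ M₀ : ℝ, 0 < M₀ ∧
      ∀ (n : ℕ) (H : Rn n → Rn n → ℝ), IsHamiltonian H → HasQuadraticGrowth H K₀ →
        IsVelocityBound H Λ M₀) := by
  constructor
  · intro n H hH Λ
    obtain ⟨m, hm0, hm⟩ := hH.exists_neg_le
    obtain ⟨U, hU0, hU⟩ := hH.exists_abs_le Λ
    obtain ⟨R, hR0, hR⟩ := hH.exists_norm_le (U + 1)
    obtain ⟨V, hV0, hV⟩ := hH.exists_abs_le (R + 1)
    exact ⟨U + 1 + 2 * m + V, by positivity,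
      isVelocityBound_of_growth hH.continuous hU0 hR0 hm
        (fun y p hp => (le_abs_self _).trans (hU y p hp)) hR
        (fun y p hp => (le_abs_self _).trans (hV y p hp))⟩
  · intro K₀ Λ
    -- Makes all constants nonnegative whatever the sign of `K₀`.
    set k := max K₀ 0
    have hk0 : 0 ≤ k := le_max_right _ _
    have hk : K₀ ≤ k := le_max_left _ _
    set U : ℝ := (Λ : ℝ) ^ 2 / 2 + k with hUdef
    -- Solves `R² / 2 - k = U + 1`, so the lower quadratic bound confines `H < U + 1` to `|p| ≤ R`.
    set R : ℝ := √(2 * (U + 1 + k)) with hRdef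
    have hU0 : 0 ≤ U := by positivity
    refine ⟨U + 1 + 2 * k + ((R + 1) ^ 2 / 2 + k), by positivity, fun n H hH hK => ?_⟩
    refine isVelocityBound_of_growth (R := R) hH.continuous hU0 (Real.sqrt_nonneg _) ?_ ?_ ?_ ?_
    · intro y p
      linarith [(hK y p).1, sq_nonneg ‖p‖]
    · intro y p hp
      have : ‖p‖ ^ 2 ≤ (Λ : ℝ) ^ 2 := by gcongr
      linarith [(hK y p).2]
    · intro y p hp
      refine Real.le_sqrt_of_sq_le ?_
      linarith [(hK y p).1]
    · intro y p hp
      have : ‖p‖ ^ 2 ≤ (R + 1) ^ 2 := by gcongr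
      linarith [(hK y p).2]
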